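/- Let $\mathbb K$ be $\mathbb R$ or $\mathbb C$; all spaces are over $\mathbb K$. Let $\Gamma$ be a set with the cardinality of the continuum and let $\{N_\gamma:\gamma\in\Gamma\}$ be a family of infinite subsets of $\mathbb N$ such that $N_\gamma\cap N_{\gamma'}$ is finite whenever $\gamma\ne\gamma'$. For each $\gamma\in\Gamma$ let $\phi_\gamma\in\ell_\infty$ be the characteristic function of $N_\gamma$. Let $JL_0$ be the linear span of $c_0\cup\{\phi_\gamma:\gamma\in\Gamma\}$ in $\ell_\infty$, endowed with the norm $$\Bigl\|y+\sum_{i=1}^k a_i\phi_{\gamma_i}\Bigr\|_{JL}=\max\Bigl\{\Bigl\|y+\sum_{i=1}^k a_i\phi_{\gamma_i}\Bigr\|_\infty,\ \Bigl(\sum_{i=1}^k|a_i|^2\Bigr)^{1/2}\Bigr\}$$ for $y\in c_0$, scalars $a_1,\dots,a_k$ and pairwise distinct $\gamma_1,\dots,\gamma_k\in\Gamma$, and let the Johnson–Lindenstrauss space $JL$ be the completion of $(JL_0,\|\cdot\|_{JL})$. Then every infinite-dimensional reflexive subspace $M$ of $JL$ is a complemented copy of $\ell_2$; that is, $M$ is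 linearly homeomorphic to $\ell_2$ and there is a continuous linear projection of $JL$ onto $M$. -/

import Mathlib

open Filter Topology
open scoped ENNReal Cardinal

universe u v

noncomputable section

/-- A family of infinite subsets of `ℕ`, indexed by `Γ`, such that any two members with different
indices have finite intersection. -/
structure AlmostDisjointFamily (Γ : Type u) where
  set : Γ → Set ℕ
  infinite_set : ∀ γ, (set γ).Infinite
  finite_inter : ∀ γ γ', γ ≠ γ' → (set γ ∩ set γ').Finite

namespace JohnsonLindenstrauss

/-- `ℓ_∞`, the bounded sequences of scalars with the supremum norm. -/
abbrev EllInfty (𝕜 : Type v) [RCLike 𝕜] : Type v := lp (fun _ : ℕ => 𝕜) ∞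

/-- `ℓ_2(Γ)`. -/
abbrev EllTwo (𝕜 : Type v) [RCLike 𝕜] (Γ : Type u) : Type (max u v) := lp (fun _ : Γ => 𝕜) 2

/-- `c_0`, the subspace of `ℓ_∞` of the sequences that converge to zero. -/
def cZero (𝕜 : Type v) [RCLike 𝕜] : Submodule 𝕜 (EllInfty 𝕜) where
  carrier := {y | Tendsto (fun n : ℕ => y n) atTop (𝓝 0)}
  zero_mem' := tendsto_const_nhds
  add_mem' := by
    intro x y hx hy
    simpa using hx.add hy
  smul_mem' := by
    intro c x hx
    simpa using hx.const_smul c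

theorem mem_cZero {𝕜 : Type v} [RCLike 𝕜] (y : EllInfty 𝕜) :
    y ∈ cZero 𝕜 ↔ Tendsto (fun n : ℕ => y n) atTop (𝓝 0) := Iff.rfl

theorem memℓp_indicator (𝕜 : Type v) [RCLike 𝕜] (s : Set ℕ) :
    Memℓp (E := fun _ : ℕ => 𝕜) (s.indicator fun _ => (1 : 𝕜)) ∞ := by
  refine memℓp_infty ⟨1, ?_⟩
  rintro _ ⟨n, rfl⟩
  by_cases h : n ∈ s <;> simp [h]

/-- The characteristic function of a set of natural numbers, as an element of `ℓ_∞`. -/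
def charFun (𝕜 : Type v) [RCLike 𝕜] (s : Set ℕ) : EllInfty 𝕜 :=
  ⟨s.indicator fun _ => (1 : 𝕜), memℓp_indicator 𝕜 s⟩

/-- A finitely supported family of scalars as an element of `ℓ_2(Γ)`. -/
def toEllTwo (𝕜 : Type v) [RCLike 𝕜] {Γ : Type u} : (Γ →₀ 𝕜) →ₗ[𝕜] EllTwo 𝕜 Γ where
  toFun a := ⟨fun γ => a γ, memℓp_gen (summable_of_ne_finset_zero (s := a.support) (by
    intro γ hγ
    simp [Finsupp.notMem_support_iff.1 hγ]))⟩
  map_add' _ _ := rfl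
  map_smul' _ _ := rfl

theorem toEllTwo_apply {𝕜 : Type v} [RCLike 𝕜] {Γ : Type u} (a : Γ →₀ 𝕜) (γ : Γ) :
    toEllTwo 𝕜 a γ = a γ := rfl

/-- `∑_γ a_γ φ_γ`, where `φ_γ` is the characteristic function of `N_γ`. -/
def phiSum (𝕜 : Type v) [RCLike 𝕜] {Γ : Type u} (N : AlmostDisjointFamily Γ) :
    (Γ →₀ 𝕜) →ₗ[𝕜] EllInfty 𝕜 :=
  Finsupp.linearCombination 𝕜 fun γ => charFun 𝕜 (N.set γ)

/-- The linear span of `c_0 ∪ {φ_γ : γ ∈ Γ}` in `ℓ_∞`. -/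
def jlSpan (𝕜 : Type v) [RCLike 𝕜] {Γ : Type u} (N : AlmostDisjointFamily Γ) :
    Submodule 𝕜 (EllInfty 𝕜) :=
  Submodule.span 𝕜 ((cZero 𝕜 : Set (EllInfty 𝕜)) ∪ Set.range fun γ => charFun 𝕜 (N.set γ))

section

variable {𝕜 : Type v} [RCLike 𝕜] {Γ : Type u} (N : AlmostDisjointFamily Γ)

theorem phiSum_apply (a : Γ →₀ 𝕜) (n : ℕ) :
    phiSum 𝕜 N a n = ∑ γ ∈ a.support, a γ * (N.set γ).indicator (fun _ => (1 : 𝕜)) n := by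
  simp only [phiSum, Finsupp.linearCombination_apply, Finsupp.sum, lp.coeFn_sum, Finset.sum_apply,
    lp.coeFn_smul, Pi.smul_apply, smul_eq_mul]
  rfl

/-- The `φ_γ` are linearly independent modulo `c_0`. -/
theorem eq_zero_of_phiSum_mem (a : Γ →₀ 𝕜) (h : phiSum 𝕜 N a ∈ cZero 𝕜) : a = 0 := by
  classical
  ext γ
  rw [mem_cZero] at h
  by_contra hne
  have hne' : a γ ≠ 0 := hne
  have hfin : (⋃ γ' ∈ a.support.erase γ, N.set γ ∩ N.set γ').Finite :=
    Set.Finite.biUnion (Finset.finite_toSet _) fun γ' hγ' =>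
      N.finite_inter γ γ' (Finset.ne_of_mem_erase hγ').symm
  have hinf := (N.infinite_set γ).sdiff hfin
  have hval : ∀ n ∈ N.set γ \ ⋃ γ' ∈ a.support.erase γ, N.set γ ∩ N.set γ',
      phiSum 𝕜 N a n = a γ := by
    rintro n ⟨hn, hn'⟩
    rw [phiSum_apply, Finset.sum_eq_single γ]
    · simp [hn]
    · intro γ' hγ' hγγ'
      have : n ∉ N.set γ' := fun hmem =>
        hn' (Set.mem_biUnion (Finset.mem_coe.2 (Finset.mem_erase.2 ⟨hγγ', hγ'⟩)) ⟨hn, hmem⟩)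
      simp [this]
    · intro hγ
      simp [Finsupp.notMem_support_iff.1 hγ]
  have hev : ∀ᶠ n in atTop, phiSum 𝕜 N a n ≠ a γ := h.eventually_ne hne'.symm
  obtain ⟨n, hn, hn'⟩ :=
    ((Nat.frequently_atTop_iff_infinite.2 hinf).and_eventually hev).exists
  exact hn' (hval n hn)

theorem phiSum_mem_jlSpan (a : Γ →₀ 𝕜) : phiSum 𝕜 N a ∈ jlSpan 𝕜 N := by
  rw [phiSum, Finsupp.linearCombination_apply]
  exact Submodule.sum_mem _ fun γ _ =>
    Submodule.smul_mem _ _ (Submodule.subset_span (Or.inr ⟨γ, rfl⟩))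

theorem cZero_le_jlSpan : cZero 𝕜 ≤ jlSpan 𝕜 N :=
  fun _ hy => Submodule.subset_span (Or.inl hy)

theorem exists_sub_phiSum_mem {x : EllInfty 𝕜} (hx : x ∈ jlSpan 𝕜 N) :
    ∃ a : Γ →₀ 𝕜, x - phiSum 𝕜 N a ∈ cZero 𝕜 := by
  have hle : jlSpan 𝕜 N ≤ cZero 𝕜 ⊔ LinearMap.range (phiSum 𝕜 N) := by
    refine Submodule.span_le.2 ?_
    rintro z (hz | ⟨γ, rfl⟩)
    · exact Submodule.mem_sup_left hz
    · exact Submodule.mem_sup_right ⟨Finsupp.single γ 1, by simp [phiSum]⟩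
  obtain ⟨y, hy, _, ⟨a, rfl⟩, rfl⟩ := Submodule.mem_sup.1 (hle hx)
  exact ⟨a, by simpa using hy⟩

theorem eq_of_sub_phiSum_mem {x : EllInfty 𝕜} {a b : Γ →₀ 𝕜} (ha : x - phiSum 𝕜 N a ∈ cZero 𝕜)
    (hb : x - phiSum 𝕜 N b ∈ cZero 𝕜) : a = b := by
  refine sub_eq_zero.1 (eq_zero_of_phiSum_mem N (a - b) ?_)
  have := (cZero 𝕜).sub_mem hb ha
  rwa [sub_sub_sub_cancel_left, ← map_sub] at this

variable (𝕜) in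
/-- The linear map `y + ∑_γ a_γ φ_γ ↦ a`, for `y` in `c_0`. -/
def coeff : jlSpan 𝕜 N →ₗ[𝕜] (Γ →₀ 𝕜) where
  toFun x := (exists_sub_phiSum_mem N x.2).choose
  map_add' x x' := by
    refine eq_of_sub_phiSum_mem N (exists_sub_phiSum_mem N (x + x').2).choose_spec ?_
    have := (cZero 𝕜).add_mem (exists_sub_phiSum_mem N x.2).choose_spec
      (exists_sub_phiSum_mem N x'.2).choose_spec
    rwa [sub_add_sub_comm, ← map_add] at this
  map_smul' c x := by
    refine eq_of_sub_phiSum_mem N (exists_sub_phiSum_mem N (c • x).2).choose_spec ?_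
    have := (cZero 𝕜).smul_mem c (exists_sub_phiSum_mem N x.2).choose_spec
    rwa [smul_sub, ← map_smul] at this

theorem coeff_eq_of_sub_mem (x : jlSpan 𝕜 N) (a : Γ →₀ 𝕜)
    (h : (x : EllInfty 𝕜) - phiSum 𝕜 N a ∈ cZero 𝕜) : coeff 𝕜 N x = a :=
  eq_of_sub_phiSum_mem N (exists_sub_phiSum_mem N x.2).choose_spec h

end

/-- The vector space `JL_0`: the span of `c_0` and the `φ_γ`, as a type of its own, because it
does not carry the norm of `ℓ_∞`. -/
def JLZero (𝕜 : Type v) [RCLike 𝕜] {Γ : Type u} (N : AlmostDisjointFamily Γ) : Type v :=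
  ↥(jlSpan 𝕜 N)

instance (𝕜 : Type v) [RCLike 𝕜] {Γ : Type u} (N : AlmostDisjointFamily Γ) :
    AddCommGroup (JLZero 𝕜 N) :=
  inferInstanceAs (AddCommGroup ↥(jlSpan 𝕜 N))

instance (𝕜 : Type v) [RCLike 𝕜] {Γ : Type u} (N : AlmostDisjointFamily Γ) :
    Module 𝕜 (JLZero 𝕜 N) :=
  inferInstanceAs (Module 𝕜 ↥(jlSpan 𝕜 N))

/-- The inclusion of `JL_0` in `ℓ_∞`. -/
def JLZero.toEllInfty (𝕜 : Type v) [RCLike 𝕜] {Γ : Type u} (N : AlmostDisjointFamily Γ) :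
    JLZero 𝕜 N →ₗ[𝕜] EllInfty 𝕜 :=
  (jlSpan 𝕜 N).subtype

/-- The linear map `JL_0 → ℓ_2(Γ)`, `y + ∑_γ a_γ φ_γ ↦ a`. -/
def JLZero.coeffs (𝕜 : Type v) [RCLike 𝕜] {Γ : Type u} (N : AlmostDisjointFamily Γ) :
    JLZero 𝕜 N →ₗ[𝕜] EllTwo 𝕜 Γ :=
  (toEllTwo 𝕜).comp (coeff 𝕜 N)

/-- The norm `‖y + ∑_γ a_γ φ_γ‖ = max {‖y + ∑_γ a_γ φ_γ‖_∞, ‖a‖_2}` of `JL_0`. -/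
def JLZero.addGroupNorm (𝕜 : Type v) [RCLike 𝕜] {Γ : Type u} (N : AlmostDisjointFamily Γ) :
    AddGroupNorm (JLZero 𝕜 N) where
  toFun x := max ‖JLZero.toEllInfty 𝕜 N x‖ ‖JLZero.coeffs 𝕜 N x‖
  map_zero' := by simp
  add_le' x y := by
    rw [map_add, map_add]
    exact max_le
      ((norm_add_le _ _).trans (add_le_add (le_max_left _ _) (le_max_left _ _)))
      ((norm_add_le _ _).trans (add_le_add (le_max_right _ _) (le_max_right _ _)))
  neg' x := by simp only [map_neg, norm_neg]
  eq_zero_of_map_eq_zero' x hx := by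
    have h0 : ‖JLZero.toEllInfty 𝕜 N x‖ = 0 :=
      le_antisymm ((le_max_left _ _).trans hx.le) (norm_nonneg _)
    exact Subtype.ext (norm_eq_zero.1 h0)

instance (𝕜 : Type v) [RCLike 𝕜] {Γ : Type u} (N : AlmostDisjointFamily Γ) :
    NormedAddCommGroup (JLZero 𝕜 N) :=
  (JLZero.addGroupNorm 𝕜 N).toNormedAddCommGroup

theorem JLZero.norm_def {𝕜 : Type v} [RCLike 𝕜] {Γ : Type u} {N : AlmostDisjointFamily Γ}
    (x : JLZero 𝕜 N) : ‖x‖ = max ‖JLZero.toEllInfty 𝕜 N x‖ ‖JLZero.coeffs 𝕜 N x‖ := rfl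

instance (𝕜 : Type v) [RCLike 𝕜] {Γ : Type u} (N : AlmostDisjointFamily Γ) :
    NormedSpace 𝕜 (JLZero 𝕜 N) where
  norm_smul_le c x := by
    rw [JLZero.norm_def, JLZero.norm_def, map_smul, map_smul, norm_smul, norm_smul,
      mul_max_of_nonneg _ _ (norm_nonneg c)]

/-- The norm of `y + ∑_γ a_γ φ_γ` in `JL_0`, for `y` in `c_0`, in terms of the
scalars `a_γ`. -/
theorem JLZero.norm_eq {𝕜 : Type v} [RCLike 𝕜] {Γ : Type u} {N : AlmostDisjointFamily Γ}
    (x : JLZero 𝕜 N) (y : EllInfty 𝕜) (hy : y ∈ cZero 𝕜) (a : Γ →₀ 𝕜)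
    (hx : JLZero.toEllInfty 𝕜 N x = y + phiSum 𝕜 N a) :
    ‖x‖ = max ‖y + phiSum 𝕜 N a‖ (Real.sqrt (∑ γ ∈ a.support, ‖a γ‖ ^ 2)) := by
  have hc : coeff 𝕜 N x = a := by
    refine coeff_eq_of_sub_mem N x a ?_
    have hx' : (Subtype.val (p := (· ∈ jlSpan 𝕜 N)) x) = y + phiSum 𝕜 N a := hx
    rw [hx', add_sub_cancel_right]
    exact hy
  have hc' : JLZero.coeffs 𝕜 N x = toEllTwo 𝕜 a := congrArg (toEllTwo 𝕜) hc
  rw [JLZero.norm_def, hx, hc']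
  congr 1
  rw [lp.norm_eq_tsum_rpow (by norm_num), Real.sqrt_eq_rpow, tsum_eq_sum (s := a.support)]
  · simp [toEllTwo_apply]
  · intro γ hγ
    simp [toEllTwo_apply, Finsupp.notMem_support_iff.1 hγ]

/-- The Johnson–Lindenstrauss space `JL` of the family `N`: the completion of `JL_0`. -/
abbrev JL (𝕜 : Type v) [RCLike 𝕜] {Γ : Type u} (N : AlmostDisjointFamily Γ) : Type v :=
  UniformSpace.Completion (JLZero 𝕜 N)

/-- A normed space is reflexive if its canonical map into the bidual is onto. -/
def Reflexive (𝕜 : Type v) [RCLike 𝕜] (E : Type u) [NormedAddCommGroup E] [NormedSpace 𝕜 E] :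
    Prop :=
  Function.Surjective (NormedSpace.inclusionInDoubleDual 𝕜 E)

end JohnsonLindenstrauss

end

/-! The coefficient map `JL.coeffs` (write `q`) sends `JL` to a Hilbert space, and each `x` is
eventually bounded by `‖q x‖ + ε` in its coordinates. If no finite set of coordinates together with
`q` controlled the norm on `M`, a gliding hump would give unit vectors, nearly killed by `q`, whose
partial sums stay bounded. By reflexivity these have a weak limit: its coordinates are eventually
small because `q` of it is small, yet they stay large at infinitely many peaks
(`exists_norm_le_of_reflexive`). So `q` plus finitely many coordinates embeds `M` in a Hilbert
space, and orthogonal projection onto the image pulls back to a projection onto `M`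
(`closedComplemented_of_norm_le`). Coordinates separate points of `JL`, so the image is separable,
hence `ℓ_2`. -/

noncomputable section

namespace JohnsonLindenstrauss

/-! ### Coordinates and coefficients on the completion -/

section Maps

variable (𝕜 : Type v) [RCLike 𝕜] {Γ : Type u} (N : AlmostDisjointFamily Γ)

/-- The inclusion of `JL_0` in `ℓ_∞` as a continuous linear map. -/
def JLZero.toEllInftyL : JLZero 𝕜 N →L[𝕜] EllInfty 𝕜 :=
  (JLZero.toEllInfty 𝕜 N).mkContinuous 1 fun x => by
    rw [one_mul, JLZero.norm_def]
    exact le_max_left _ _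

/-- The coefficient map `JL_0 → ℓ_2(Γ)` as a continuous linear map. -/
def JLZero.coeffsL : JLZero 𝕜 N →L[𝕜] EllTwo 𝕜 Γ :=
  (JLZero.coeffs 𝕜 N).mkContinuous 1 fun x => by
    rw [one_mul, JLZero.norm_def]
    exact le_max_right _ _

/-- The continuous extension to `JL` of the inclusion of `JL_0` in `ℓ_∞`. -/
def JL.toEllInfty : JL 𝕜 N →L[𝕜] EllInfty 𝕜 :=
  (JLZero.toEllInftyL 𝕜 N).extend UniformSpace.Completion.toComplL

/-- The continuous extension to `JL` of the coefficient map of `JL_0`. -/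
def JL.coeffs : JL 𝕜 N →L[𝕜] EllTwo 𝕜 Γ :=
  (JLZero.coeffsL 𝕜 N).extend UniformSpace.Completion.toComplL

variable {𝕜 N}

theorem JL.toEllInfty_coe (x : JLZero 𝕜 N) :
    JL.toEllInfty 𝕜 N (x : JL 𝕜 N) = JLZero.toEllInfty 𝕜 N x :=
  ContinuousLinearMap.extend_eq (e := UniformSpace.Completion.toComplL) _
    UniformSpace.Completion.denseRange_coe
    (UniformSpace.Completion.isUniformInducing_coe _) x

theorem JL.coeffs_coe (x : JLZero 𝕜 N) :
    JL.coeffs 𝕜 N (x : JL 𝕜 N) = JLZero.coeffs 𝕜 N x :=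
  ContinuousLinearMap.extend_eq (e := UniformSpace.Completion.toComplL) _
    UniformSpace.Completion.denseRange_coe
    (UniformSpace.Completion.isUniformInducing_coe _) x

theorem JL.norm_eq_max (x : JL 𝕜 N) :
    ‖x‖ = max ‖JL.toEllInfty 𝕜 N x‖ ‖JL.coeffs 𝕜 N x‖ := by
  induction x using UniformSpace.Completion.induction_on with
  | hp => exact isClosed_eq (by fun_prop) (by fun_prop)
  | ih x =>
    rw [UniformSpace.Completion.norm_coe, JL.toEllInfty_coe, JL.coeffs_coe, JLZero.norm_def]

theorem JLZero.tendsto_sub_phiSum (x : JLZero 𝕜 N) :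
    Tendsto (fun n => JLZero.toEllInfty 𝕜 N x n - phiSum 𝕜 N (coeff 𝕜 N x) n) atTop (𝓝 0) := by
  obtain ⟨a, ha⟩ := exists_sub_phiSum_mem N (x := JLZero.toEllInfty 𝕜 N x) x.2
  have hc : coeff 𝕜 N x = a := coeff_eq_of_sub_mem N x a ha
  rw [hc]
  exact (mem_cZero _).1 ha

variable (N) in
/-- At all but finitely many coordinates, at most one of finitely many `φ_γ` is nonzero. -/
theorem eventually_norm_phiSum_le (a : Γ →₀ 𝕜) {C : ℝ} (hC : ∀ γ, ‖a γ‖ ≤ C) (hC0 : 0 ≤ C) :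
    ∀ᶠ n in atTop, ‖phiSum 𝕜 N a n‖ ≤ C := by
  classical
  have hfin : (⋃ γ ∈ a.support, ⋃ γ' ∈ a.support.erase γ, N.set γ ∩ N.set γ').Finite :=
    Set.Finite.biUnion (Finset.finite_toSet _) fun γ _ =>
      Set.Finite.biUnion (Finset.finite_toSet _) fun γ' hγ' =>
        N.finite_inter γ γ' (Finset.ne_of_mem_erase hγ').symm
  have hev := hfin.compl_mem_cofinite
  rw [Nat.cofinite_eq_atTop] at hev
  filter_upwards [hev] with n hn
  rw [phiSum_apply]
  by_cases h : ∃ γ ∈ a.support, n ∈ N.set γ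
  · obtain ⟨γ, hγ, hnγ⟩ := h
    rw [Finset.sum_eq_single_of_mem γ hγ]
    · simpa [hnγ] using hC γ
    · intro γ' hγ' hne
      have : n ∉ N.set γ' := fun hmem => hn (by
        simp only [Set.mem_iUnion]
        exact ⟨γ, hγ, γ', Finset.mem_erase.2 ⟨hne, hγ'⟩, hnγ, hmem⟩)
      simp [this]
  · push Not at h
    rw [Finset.sum_eq_zero]
    · simpa using hC0
    · intro γ hγ
      simp [h γ hγ]

-- Removing from `N.set γ` its finite intersections with the other sets in the support leaves an
-- infinite set, where only the term of `γ` survives.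
variable (N) in
theorem frequently_phiSum_eq (a : Γ →₀ 𝕜) (γ : Γ) :
    ∃ᶠ n in atTop, phiSum 𝕜 N a n = a γ := by
  classical
  have hfin : (⋃ γ' ∈ a.support.erase γ, N.set γ ∩ N.set γ').Finite :=
    Set.Finite.biUnion (Finset.finite_toSet _) fun γ' hγ' =>
      N.finite_inter γ γ' (Finset.ne_of_mem_erase hγ').symm
  have hinf := (N.infinite_set γ).sdiff hfin
  refine (Nat.frequently_atTop_iff_infinite.2 hinf).mono ?_
  rintro n ⟨hn, hn'⟩
  rw [phiSum_apply, Finset.sum_eq_single γ]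
  · simp [hn]
  · intro γ' hγ' hγγ'
    have : n ∉ N.set γ' := fun hmem =>
      hn' (Set.mem_biUnion (Finset.mem_coe.2 (Finset.mem_erase.2 ⟨hγγ', hγ'⟩)) ⟨hn, hmem⟩)
    simp [this]
  · intro hγ
    simp [Finsupp.notMem_support_iff.1 hγ]

theorem JLZero.eventually_norm_apply_le (x : JLZero 𝕜 N) {ε : ℝ} (hε : 0 < ε) :
    ∀ᶠ n in atTop, ‖JLZero.toEllInfty 𝕜 N x n‖ ≤ ‖JLZero.coeffs 𝕜 N x‖ + ε := by
  have h1 := (JLZero.tendsto_sub_phiSum x).norm.eventually (gt_mem_nhds (by simpa using hε))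
  have h2 := eventually_norm_phiSum_le N (coeff 𝕜 N x) (C := ‖JLZero.coeffs 𝕜 N x‖)
    (fun γ => lp.norm_apply_le_norm (by norm_num) (JLZero.coeffs 𝕜 N x) γ) (norm_nonneg _)
  filter_upwards [h1, h2] with n h1 h2
  have := norm_le_norm_sub_add (JLZero.toEllInfty 𝕜 N x n) (phiSum 𝕜 N (coeff 𝕜 N x) n)
  linarith

/-- Up to an error tending to zero, `x` takes its coefficient at `γ` as a value infinitely often. -/
theorem JLZero.norm_coeffs_apply_le (x : JLZero 𝕜 N) (γ : Γ) :
    ‖JLZero.coeffs 𝕜 N x γ‖ ≤ ‖JLZero.toEllInfty 𝕜 N x‖ := by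
  refine le_of_forall_pos_le_add fun ε hε => ?_
  have h1 := (JLZero.tendsto_sub_phiSum x).norm.eventually (gt_mem_nhds (by simpa using hε))
  obtain ⟨n, hn, hn'⟩ := ((frequently_phiSum_eq N (coeff 𝕜 N x) γ).and_eventually h1).exists
  rw [hn, norm_sub_rev] at hn'
  have h2 := lp.norm_apply_le_norm ENNReal.top_ne_zero (JLZero.toEllInfty 𝕜 N x) n
  have h3 := norm_le_norm_sub_add (coeff 𝕜 N x γ) (JLZero.toEllInfty 𝕜 N x n)
  have h4 : JLZero.coeffs 𝕜 N x γ = coeff 𝕜 N x γ := rfl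
  rw [h4]
  linarith

/-- The distance of `x` to `c_0` is at most the norm of its coefficients. -/
theorem JL.eventually_norm_apply_le (x : JL 𝕜 N) {ε : ℝ} (hε : 0 < ε) :
    ∀ᶠ n in atTop, ‖JL.toEllInfty 𝕜 N x n‖ ≤ ‖JL.coeffs 𝕜 N x‖ + ε := by
  obtain ⟨y, hy⟩ : ∃ y : JLZero 𝕜 N, ‖x - (y : JL 𝕜 N)‖ < ε / 3 := by
    obtain ⟨y, hy⟩ := UniformSpace.Completion.denseRange_coe.exists_dist_lt x
      (show 0 < ε / 3 by positivity)
    exact ⟨y, by rwa [← dist_eq_norm]⟩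
  have hmax := JL.norm_eq_max (x - (y : JL 𝕜 N))
  rw [map_sub, map_sub, JL.toEllInfty_coe, JL.coeffs_coe] at hmax
  have h1 : ‖JL.toEllInfty 𝕜 N x - JLZero.toEllInfty 𝕜 N y‖ ≤ ‖x - (y : JL 𝕜 N)‖ :=
    hmax ▸ le_max_left _ _
  have h2 : ‖JL.coeffs 𝕜 N x - JLZero.coeffs 𝕜 N y‖ ≤ ‖x - (y : JL 𝕜 N)‖ := hmax ▸ le_max_right _ _
  filter_upwards [JLZero.eventually_norm_apply_le y (show 0 < ε / 3 by positivity)] with n hn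
  have h3 := lp.norm_apply_le_norm ENNReal.top_ne_zero
    (JL.toEllInfty 𝕜 N x - JLZero.toEllInfty 𝕜 N y) n
  rw [lp.coeFn_sub, Pi.sub_apply] at h3
  have h4 := norm_le_norm_sub_add (JL.toEllInfty 𝕜 N x n) (JLZero.toEllInfty 𝕜 N y n)
  have h5 := norm_le_norm_sub_add (JLZero.coeffs 𝕜 N y) (JL.coeffs 𝕜 N x)
  rw [norm_sub_rev] at h5
  linarith

/-- The continuous linear functional `x ↦ x n` on `ℓ_∞`. -/
def EllInfty.coord (𝕜 : Type v) [RCLike 𝕜] (n : ℕ) : EllInfty 𝕜 →L[𝕜] 𝕜 :=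
  LinearMap.mkContinuous
    { toFun := fun x => x n
      map_add' := fun _ _ => rfl
      map_smul' := fun _ _ => rfl } 1 fun x => by
    rw [one_mul]
    exact lp.norm_apply_le_norm ENNReal.top_ne_zero x n

theorem JL.norm_coeffs_apply_le (x : JL 𝕜 N) (γ : Γ) :
    ‖JL.coeffs 𝕜 N x γ‖ ≤ ‖JL.toEllInfty 𝕜 N x‖ := by
  induction x using UniformSpace.Completion.induction_on with
  | hp =>
    refine isClosed_le (Continuous.norm ?_) (by fun_prop)
    exact (continuous_apply γ).comp
      ((lp.uniformContinuous_coe (E := fun _ : Γ => 𝕜) (p := 2)).continuous.comp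
        (JL.coeffs 𝕜 N).continuous)
  | ih x =>
    rw [JL.toEllInfty_coe, JL.coeffs_coe]
    exact JLZero.norm_coeffs_apply_le x γ

/-- Extending an injective map to a completion may create a kernel; here the sup norm also controls
each coefficient, so none appears. -/
theorem JL.eq_zero_of_forall_apply_eq_zero (x : JL 𝕜 N)
    (hx : ∀ n, JL.toEllInfty 𝕜 N x n = 0) : x = 0 := by
  have h1 : JL.toEllInfty 𝕜 N x = 0 := lp.ext (funext hx)
  have h2 : JL.coeffs 𝕜 N x = 0 := by
    refine lp.ext (funext fun γ => ?_)
    have := JL.norm_coeffs_apply_le x γ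
    rw [h1, norm_zero] at this
    exact norm_le_zero_iff.1 this
  rw [← norm_eq_zero, JL.norm_eq_max, h1, h2]
  simp

end Maps

end JohnsonLindenstrauss

end

/-! ### Weak limits and completeness from reflexivity -/

/-- In a reflexive space, every bounded sequence converges weakly along some ultrafilter. -/
theorem exists_weak_limit_of_reflexive {𝕜 : Type v} [RCLike 𝕜] {E : Type u}
    [NormedAddCommGroup E] [NormedSpace 𝕜 E] (hE : JohnsonLindenstrauss.Reflexive 𝕜 E)
    (s : ℕ → E) {C : ℝ} (hs : ∀ k, ‖s k‖ ≤ C) :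
    ∃ x : E, ∀ f : StrongDual 𝕜 E, Tendsto (fun k => f (s k)) (hyperfilter ℕ) (𝓝 (f x)) := by
  let Φ : ℕ → WeakDual 𝕜 (StrongDual 𝕜 E) := fun k =>
    StrongDual.toWeakDual (NormedSpace.inclusionInDoubleDual 𝕜 E (s k))
  have hcpt := WeakDual.isCompact_closedBall (𝕜 := 𝕜) (E := StrongDual 𝕜 E) 0 C
  have hmem : ∀ k, Φ k ∈ WeakDual.toStrongDual ⁻¹' Metric.closedBall 0 C := fun k =>
    (mem_closedBall_zero_iff (E := StrongDual 𝕜 (StrongDual 𝕜 E))).2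
      ((NormedSpace.double_dual_bound 𝕜 E (s k)).trans (hs k))
  -- Banach–Alaoglu in the bidual; reflexivity then brings the limit back to `E`.
  obtain ⟨Ψ, -, hΨ⟩ := hcpt.ultrafilter_le_nhds ((hyperfilter ℕ).map Φ)
    (le_principal_iff.2 (Filter.mem_map.2 (Filter.univ_mem' hmem)))
  obtain ⟨x, hx⟩ := hE (WeakDual.toStrongDual Ψ)
  refine ⟨x, fun f => ?_⟩
  have h1 : Tendsto (fun k => Φ k f) (hyperfilter ℕ) (𝓝 (Ψ f)) :=
    ((WeakDual.eval_continuous f).tendsto Ψ).comp hΨ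
  have h2 : Ψ f = f x := by
    rw [← NormedSpace.dual_def 𝕜 E x f, hx]
    rfl
  rw [← h2]
  exact h1

theorem completeSpace_of_reflexive {𝕜 : Type v} [RCLike 𝕜] {E : Type u}
    [NormedAddCommGroup E] [NormedSpace 𝕜 E] (hE : JohnsonLindenstrauss.Reflexive 𝕜 E) :
    CompleteSpace E := by
  have h := (NormedSpace.inclusionInDoubleDualLi (E := E) 𝕜).isometry
  refine (h.isUniformInducing.completeSpace_congr ?_).2 inferInstance
  exact hE

/-! ### The gliding hump -/

namespace JohnsonLindenstrauss

/-- The partial sums of a gliding hump, with the prescribed choice `X` of the humps and `m` of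
the coordinates that a hump has to avoid. -/
def glidingSum {E : Type*} [AddCommMonoid E] (X : ℕ → ℕ → E) (m : E → ℕ) : ℕ → E
  | 0 => 0
  | k + 1 => glidingSum X m k + X k (max k (m (glidingSum X m k)))

/-- If a normed space `E` maps to `ℓ_∞` and to `F` with `x` in `E` eventually of size `‖q x‖`
and `‖x‖ = max (‖J x‖, ‖q x‖)`, then on a reflexive subspace the norm is controlled by `q` and
finitely many coordinates. -/
theorem exists_norm_le_of_reflexive {𝕜 : Type v} [RCLike 𝕜] {E F : Type*}
    [NormedAddCommGroup E] [NormedSpace 𝕜 E] [NormedAddCommGroup F] [NormedSpace 𝕜 F]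
    (J : E →L[𝕜] EllInfty 𝕜) (q : E →L[𝕜] F)
    (hnorm : ∀ x, ‖x‖ = max ‖J x‖ ‖q x‖)
    (hev : ∀ x, ∀ ε > 0, ∀ᶠ n in atTop, ‖J x n‖ ≤ ‖q x‖ + ε) (hE : Reflexive 𝕜 E) :
    ∃ n : ℕ, ∃ ε > 0, ∀ x : E, ‖x‖ = 1 → ‖q x‖ ≤ ε → ∃ j < n, ε < ‖J x j‖ := by
  by_contra! hcon
  -- The `ε k` sum to `1 / 10`; `hε1` makes them telescope in the inductions below.
  let ε : ℕ → ℝ := fun k => (1 / 10) * (1 / 2) ^ (k + 1)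
  have hε : ∀ k, 0 < ε k := fun k => by positivity
  have hε1 : ∀ k, ε k = (1 / 10) * (1 / 2) ^ k - (1 / 10) * (1 / 2) ^ (k + 1) := fun k => by
    simp only [ε]; ring
  have hε2 : ∀ k, ε k ≤ 1 / 10 := fun k => by
    have : (1 / 2 : ℝ) ^ (k + 1) ≤ 1 := pow_le_one₀ (by norm_num) (by norm_num)
    simp only [ε]; linarith
  choose X hX1 hXq hXJ using fun k n => hcon n (ε k) (hε k)
  choose m hm using fun x => eventually_atTop.1 (hev x (1 / 10) (by norm_num))
  let s := glidingSum X m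
  -- From `m (s k)` on, `s k` is small; the `k` pushes the humps to infinity.
  let M : ℕ → ℕ := fun k => max k (m (s k))
  let x : ℕ → E := fun k => X k (M k)
  have hs : ∀ k, s (k + 1) = s k + x k := fun k => rfl
  have hpow : ∀ k : ℕ, (0 : ℝ) < (1 / 10) * (1 / 2) ^ k := fun k => by positivity
  have hpow1 : ∀ k : ℕ, (1 / 10 : ℝ) * (1 / 2) ^ k ≤ 1 / 10 := fun k => by
    have : (1 / 2 : ℝ) ^ k ≤ 1 := pow_le_one₀ (by norm_num) (by norm_num)
    linarith
  have hJn : ∀ (y : E) j, ‖J y j‖ ≤ ‖J y‖ := fun y j =>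
    lp.norm_apply_le_norm ENNReal.top_ne_zero (J y) j
  have hsj : ∀ k j, J (s (k + 1)) j = J (s k) j + J (x k) j := fun k j => by
    rw [hs, map_add, lp.coeFn_add, Pi.add_apply]
  have hsq : ∀ k, ‖q (s k)‖ ≤ 1 / 10 - (1 / 10) * (1 / 2) ^ k := by
    intro k
    induction k with
    | zero => simp [s, glidingSum]
    | succ k ih =>
      rw [hs, map_add]
      have := norm_add_le (q (s k)) (q (x k))
      have h2 : ‖q (x k)‖ ≤ ε k := hXq k (M k)
      rw [hε1] at h2
      linarith
  have hsq' : ∀ k, ‖q (s k)‖ ≤ 1 / 10 := fun k => by linarith [hsq k, hpow k]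
  have hx1 : ∀ k, ‖x k‖ = 1 := fun k => hX1 k (M k)
  have hlow : ∀ k, ∀ j < M k, ‖J (x k) j‖ ≤ ε k := fun k => hXJ k (M k)
  have hhigh : ∀ k, ∀ j, M k ≤ j → ‖J (s k) j‖ ≤ 1 / 5 := fun k j hj => by
    have := hm (s k) j ((le_max_right _ _).trans hj)
    linarith [hsq' k]
  have hJx : ∀ k, ‖J (x k)‖ = 1 := fun k => by
    have h1 := hnorm (x k)
    have h2 : ‖q (x k)‖ ≤ ε k := hXq k (M k)
    rw [hx1] at h1
    rcases max_choice ‖J (x k)‖ ‖q (x k)‖ with h | h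
    · rw [← h, ← h1]
    · linarith [hε2 k]
  -- Before `M k` the new hump adds at most `ε k`; from `M k` on the sum is at most `1 / 5 + 1`.
  have hsJ : ∀ k, ‖J (s k)‖ ≤ 2 - (1 / 10) * (1 / 2) ^ k := by
    intro k
    induction k with
    | zero => simp [s, glidingSum]; norm_num
    | succ k ih =>
      refine lp.norm_le_of_forall_le (by linarith [hpow1 (k + 1)]) fun j => ?_
      rw [hsj]
      have h1 := norm_add_le (J (s k) j) (J (x k) j)
      rcases lt_or_ge j (M k) with hj | hj
      · have h2 := hlow k j hj
        rw [hε1] at h2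
        linarith [hJn (s k) j]
      · have h2 := hhigh k j hj
        have h3 := hJn (x k) j
        rw [hJx] at h3
        linarith [hpow1 (k + 1)]
  have hbd : ∀ k, ‖s k‖ ≤ 2 := fun k => by
    rw [hnorm]
    exact max_le (by linarith [hsJ k, hpow k]) (by linarith [hsq' k])
  -- A peak of `x k` above `9 / 10` loses at most `1 / 5` to `s k`, and later humps remove at most
  -- `1 / 10` in total.
  have hpeak : ∀ k, ∃ j, k ≤ j ∧ ∀ i, 7 / 10 - (1 / 10 - (1 / 10) * (1 / 2) ^ i) ≤
      ‖J (s (k + 1 + i)) j‖ := by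
    intro k
    obtain ⟨j, hj⟩ : ∃ j, 9 / 10 < ‖J (x k) j‖ := by
      by_contra! h
      have := lp.norm_le_of_forall_le (by norm_num) h
      rw [hJx] at this
      norm_num at this
    have hMj : M k ≤ j := by
      by_contra! h
      linarith [hlow k j h, hε2 k]
    refine ⟨j, (le_max_left _ _).trans hMj, fun i => ?_⟩
    induction i with
    | zero =>
      rw [add_zero, hsj]
      have h1 := norm_le_add_norm_add (J (x k) j) (J (s k) j)
      rw [add_comm] at h1
      have h2 := hhigh k j hMj
      rw [add_comm (J (s k) j)]
      norm_num
      linarith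
    | succ i ih =>
      -- Otherwise the partial sum would be at most `1 / 5` at `j`, where it still exceeds `6 / 10`.
      have hlt : j < M (k + 1 + i) := by
        by_contra! h
        linarith [hhigh _ j h, hpow i]
      have h1 := hlow _ j hlt
      rw [← add_assoc, hsj]
      have h2 := norm_le_add_norm_add (J (s (k + 1 + i)) j) (J (x (k + 1 + i)) j)
      have h3 : ε (k + 1 + i) ≤ ε i := by
        simp only [ε]
        have : (1 / 2 : ℝ) ^ (k + 1 + i + 1) ≤ (1 / 2) ^ (i + 1) :=
          pow_le_pow_of_le_one (by norm_num) (by norm_num) (by omega)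
        linarith
      rw [hε1 i] at h3
      linarith
  obtain ⟨z, hz⟩ := exists_weak_limit_of_reflexive hE s hbd
  have hzJ : ∀ j, Tendsto (fun k => ‖J (s k) j‖) (hyperfilter ℕ) (𝓝 ‖J z j‖) := fun j =>
    (hz ((EllInfty.coord 𝕜 j).comp J)).norm
  have hzq : ‖q z‖ ≤ 1 / 10 := by
    obtain ⟨g, hg1, hg⟩ := exists_dual_vector'' 𝕜 (q z)
    have h1 := (hz (g.comp q)).norm
    have h2 : ‖(g.comp q) z‖ = ‖q z‖ := by
      rw [ContinuousLinearMap.comp_apply, hg]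
      simp
    rw [h2] at h1
    refine le_of_tendsto h1 (Eventually.of_forall fun k => ?_)
    have h3 := g.le_of_opNorm_le hg1 (q (s k))
    rw [one_mul] at h3
    exact h3.trans (hsq' k)
  obtain ⟨k, hk⟩ := eventually_atTop.1 (hev z (1 / 10) (by norm_num))
  obtain ⟨j, hkj, hj⟩ := hpeak k
  have h6 : 6 / 10 ≤ ‖J z j‖ := by
    refine ge_of_tendsto (hzJ j) ?_
    have : ∀ᶠ n in atTop, 6 / 10 ≤ ‖J (s n) j‖ := by
      filter_upwards [eventually_ge_atTop (k + 1)] with n hn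
      obtain ⟨i, rfl⟩ := Nat.exists_eq_add_of_le hn
      linarith [hj i, hpow i]
    exact Nat.hyperfilter_le_atTop this
  linarith [hk j hkj]

end JohnsonLindenstrauss

/-! ### Separability and complementation through Hilbert space -/

/-- An infinite-dimensional Hilbert space with a countable total set of functionals is isometric
to `ℓ_2`. -/
theorem nonempty_linearIsometryEquiv_ellTwo {𝕜 : Type v} [RCLike 𝕜] {H : Type*}
    [NormedAddCommGroup H] [InnerProductSpace 𝕜 H] [CompleteSpace H]
    (hH : ¬ FiniteDimensional 𝕜 H) (g : ℕ → StrongDual 𝕜 H)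
    (hg : ∀ x, (∀ n, g n x = 0) → x = 0) :
    Nonempty (H ≃ₗᵢ[𝕜] lp (fun _ : ℕ => 𝕜) 2) := by
  obtain ⟨w, b, -⟩ := exists_hilbertBasis 𝕜 H
  have hcount : Countable w := by
    -- By Riesz and Bessel each `g n` is nonzero on only countably many basis vectors; totality
    -- leaves no basis vector unseen.
    have hU : (⋃ n, Function.support fun i : w => g n (b i)).Countable := by
      refine Set.countable_iUnion fun n => ?_
      refine (b.orthonormal.inner_products_summable
        ((InnerProductSpace.toDual 𝕜 H).symm (g n))).countable_support.mono fun i hi => ?_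
      rw [Function.mem_support] at hi ⊢
      rw [← InnerProductSpace.toDual_symm_apply] at hi
      rw [← norm_ne_zero_iff, norm_inner_symm] at hi
      exact pow_ne_zero 2 hi
    refine Set.countable_univ_iff.1 (hU.mono fun i _ => ?_)
    by_contra hi
    simp only [Set.mem_iUnion, Function.mem_support, not_exists, not_not] at hi
    exact b.orthonormal.ne_zero i (hg _ hi)
  have hinf : Infinite w := by
    by_contra hfin
    rw [not_infinite_iff_finite] at hfin
    have := Fintype.ofFinite w
    exact hH b.toOrthonormalBasis.toBasis.finiteDimensional_of_finite
  obtain ⟨e⟩ := nonempty_equiv_of_countable (α := ℕ) (β := w)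
  have hrange : Set.range (b ∘ e) = Set.range b := e.surjective.range_comp b
  refine ⟨(HilbertBasis.mk (b.orthonormal.comp e e.injective) ?_).repr⟩
  rw [hrange, b.dense_span]

/-- A complete subspace on which a map to a Hilbert space is bounded below is complemented, and
isomorphic to `ℓ_2` if it is infinite-dimensional and has a countable total set of functionals. -/
theorem closedComplemented_of_norm_le {𝕜 : Type v} [RCLike 𝕜] {E H : Type*}
    [NormedAddCommGroup E] [NormedSpace 𝕜 E] [NormedAddCommGroup H] [InnerProductSpace 𝕜 H]
    [CompleteSpace H] (T : E →L[𝕜] H) (M : Submodule 𝕜 E) [CompleteSpace M]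
    (hM : ¬ FiniteDimensional 𝕜 M) {C : NNReal} (hT : ∀ x ∈ M, ‖x‖ ≤ C * ‖T x‖)
    (g : ℕ → StrongDual 𝕜 E) (hg : ∀ x, (∀ n, g n x = 0) → x = 0) :
    Nonempty (M ≃L[𝕜] lp (fun _ : ℕ => 𝕜) 2) ∧ M.ClosedComplemented := by
  let S : M →L[𝕜] H := T.comp M.subtypeL
  have hanti : AntilipschitzWith C S :=
    ContinuousLinearMap.antilipschitz_of_bound S fun x => hT x x.2
  have hclosed : IsClosed (Set.range S) := hanti.isClosed_range S.uniformContinuous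
  let e : M ≃L[𝕜] S.range := S.equivRange hanti.injective hclosed
  have : CompleteSpace S.range := IsClosed.completeSpace_coe (hs := hclosed)
  constructor
  · have hinf : ¬ FiniteDimensional 𝕜 S.range := fun h =>
      hM (e.symm.toLinearEquiv.finiteDimensional)
    obtain ⟨f⟩ := nonempty_linearIsometryEquiv_ellTwo hinf
      (fun n => (g n).comp (M.subtypeL.comp (e.symm : S.range →L[𝕜] M))) fun y hy =>
        e.symm.map_eq_zero_iff.1 (Subtype.ext (hg _ hy))
    exact ⟨e.trans f.toContinuousLinearEquiv⟩
  -- On `M` the map `T` already lands in the range of `S`, so the projection is idle there and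
  -- `e.symm` undoes `T`.
  · refine ⟨(e.symm : S.range →L[𝕜] M).comp (S.range.orthogonalProjectionOnto.comp T),
      fun x => ?_⟩
    have h1 : T (x : E) = (e x : H) := rfl
    simp only [ContinuousLinearMap.comp_apply]
    rw [h1, Submodule.orthogonalProjectionOnto_mem_subspace_eq_self]
    exact e.symm_apply_apply x

/-! ### The embedding of `M` by coefficients and finitely many coordinates -/

theorem mainTheorem6 {𝕜 : Type v} [RCLike 𝕜] {Γ : Type u} (hΓ : #Γ = 𝔠)
    (N : AlmostDisjointFamily Γ) (M : Submodule 𝕜 (JohnsonLindenstrauss.JL 𝕜 N))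
    (hM : ¬ FiniteDimensional 𝕜 M) (hrefl : JohnsonLindenstrauss.Reflexive 𝕜 M) :
    Nonempty (M ≃L[𝕜] lp (fun _ : ℕ => 𝕜) 2) ∧ M.ClosedComplemented := by
  open JohnsonLindenstrauss in
  have : CompleteSpace M := completeSpace_of_reflexive hrefl
  obtain ⟨n, ε, hε, h⟩ := exists_norm_le_of_reflexive ((JL.toEllInfty 𝕜 N).comp M.subtypeL)
    ((JL.coeffs 𝕜 N).comp M.subtypeL) (fun x => JL.norm_eq_max (x : JL 𝕜 N))
    (fun x ε hε => JL.eventually_norm_apply_le (x : JL 𝕜 N) hε) hrefl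
  let g : ℕ → StrongDual 𝕜 (JL 𝕜 N) := fun j =>
    (EllInfty.coord 𝕜 j).comp (JL.toEllInfty 𝕜 N)
  -- The `ℓ_2` product, rather than the sup product, makes the target a Hilbert space.
  let T : JL 𝕜 N →L[𝕜] WithLp 2 (EllTwo 𝕜 Γ × EuclideanSpace 𝕜 (Fin n)) :=
    ((WithLp.prodContinuousLinearEquiv 2 𝕜 (EllTwo 𝕜 Γ) (EuclideanSpace 𝕜 (Fin n))).symm :
      EllTwo 𝕜 Γ × EuclideanSpace 𝕜 (Fin n) →L[𝕜] _).comp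
      ((JL.coeffs 𝕜 N).prod (((EuclideanSpace.equiv (Fin n) 𝕜).symm :
        (Fin n → 𝕜) →L[𝕜] EuclideanSpace 𝕜 (Fin n)).comp
          (ContinuousLinearMap.pi fun j : Fin n => g j)))
  have hTq : ∀ x, ‖JL.coeffs 𝕜 N x‖ ≤ ‖T x‖ := fun x => WithLp.norm_fst_le _ (T x)
  have hTg : ∀ x, ∀ j < n, ‖JL.toEllInfty 𝕜 N x j‖ ≤ ‖T x‖ := fun x j hj =>
    (PiLp.norm_apply_le (T x).snd ⟨j, hj⟩).trans (WithLp.norm_snd_le _ (T x))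
  have hT1 : ∀ x : M, ‖x‖ = 1 → ε ≤ ‖T x‖ := fun x hx => by
    by_cases hq : ‖JL.coeffs 𝕜 N (x : JL 𝕜 N)‖ ≤ ε
    · obtain ⟨j, hj, hlt⟩ := h x hx hq
      exact hlt.le.trans (hTg _ j hj)
    · exact (not_le.1 hq).le.trans (hTq _)
  refine closedComplemented_of_norm_le T M hM (C := ⟨ε⁻¹, by positivity⟩) (fun x hx => ?_) g
    JL.eq_zero_of_forall_apply_eq_zero
  rcases eq_or_ne x 0 with rfl | hne
  · simp
  have hpos : 0 < ‖x‖ := norm_pos_iff.2 hne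
  have h1 := hT1 (((‖x‖⁻¹ : ℝ) : 𝕜) • (⟨x, hx⟩ : M)) (by
    rw [norm_smul, RCLike.norm_ofReal, abs_of_pos (by positivity)]
    exact inv_mul_cancel₀ hpos.ne')
  rw [Submodule.coe_smul, map_smul, norm_smul, RCLike.norm_ofReal,
    abs_of_pos (by positivity)] at h1
  change ‖x‖ ≤ ε⁻¹ * ‖T x‖
  rw [inv_mul_eq_div, le_div_iff₀ hε]
  rw [inv_mul_eq_div, le_div_iff₀ hpos] at h1
  linarith
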